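/- For a probability measure $\mathbb P$ on $\mathbb R^p$ and $\eta\in\mathbb R^p$, let $\mathcal D(\eta,\mathbb P)=\inf_{\|u\|=1}\mathbb P\{x:u^Tx\le u^T\eta\}$ be Tukey's depth. A Tukey median of a sample $X_1,\dots,X_n\in\mathbb R^p$ is any $\hat\theta\in\mathbb R^p$ that maximizes $\eta\mapsto\mathcal D(\eta,\mathbb P_n)$ over $\mathbb R^p$, where $\mathbb P_n=\frac1n\sum_{i=1}^n\delta_{X_i}$. There exist absolute constants $c,C,C'>0$ such that the following holds for all integers $p,n\ge 1$ with $p/n<c$, all $\epsilon\in[0,1/4)$, all $\theta\in\mathbb R^p$ and all probability measures $Q$ on $\mathbb R^p$. Let $X_1,\dots,X_n$ be i.i.d. from $(1-\epsilon)N(\theta,I_p)+\epsilon Q$. Then, with probability at least $1-\exp\left(-C'(p+n\epsilon^2)\right)$, every Tukey median $\hat\theta$ of $X_1,\dots,X_n$ satisfies $$\|\hat\theta-\theta\|^2\le C\left(\frac pn\vee\epsilon^2\right),$$ where $\|\cdot\|$ is the Euclidean norm and $a\vee b=\max(a,b)$. -/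

import Mathlib

open MeasureTheory ProbabilityTheory
open scoped ENNReal RealInnerProductSpace

noncomputable section

/-- Tukey's depth of `η` with respect to a distribution `P` on `ℝ^p`: the infimum over the unit
sphere of the mass of the half-spaces `{x : ⟪u, x⟫ ≤ ⟪u, η⟫}`. -/
def tukeyDepth {p : ℕ} (η : EuclideanSpace ℝ (Fin p))
    (P : Measure (EuclideanSpace ℝ (Fin p))) : ℝ :=
  ⨅ u : Metric.sphere (0 : EuclideanSpace ℝ (Fin p)) 1,
    P.real {x | ⟪(u : EuclideanSpace ℝ (Fin p)), x⟫ ≤ ⟪(u : EuclideanSpace ℝ (Fin p)), η⟫}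

/-- The empirical distribution `(1/n) ∑ δ_{X_i}` of a sample `X`. -/
def empiricalDistribution {p n : ℕ} (X : Fin n → EuclideanSpace ℝ (Fin p)) :
    Measure (EuclideanSpace ℝ (Fin p)) :=
  (n : ℝ≥0∞)⁻¹ • ∑ i : Fin n, Measure.dirac (X i)

/-- `θhat` is a Tukey median of the sample `X`: a point of maximal empirical depth. -/
def IsTukeyMedian {p n : ℕ} (X : Fin n → EuclideanSpace ℝ (Fin p))
    (θhat : EuclideanSpace ℝ (Fin p)) : Prop :=
  ∀ η : EuclideanSpace ℝ (Fin p),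
    tukeyDepth η (empiricalDistribution X) ≤ tukeyDepth θhat (empiricalDistribution X)

/-- The contaminated distribution `(1 - ε) N(θ, I_p) + ε Q`. -/
def contaminatedGaussian {p : ℕ} (ε : ℝ) (θ : EuclideanSpace ℝ (Fin p))
    (Q : Measure (EuclideanSpace ℝ (Fin p))) : Measure (EuclideanSpace ℝ (Fin p)) :=
  ENNReal.ofReal (1 - ε) • multivariateGaussian θ (1 : Matrix (Fin p) (Fin p) ℝ) +
    ENNReal.ofReal ε • Q

/-- The contaminated distribution is a probability measure. -/
theorem isProbabilityMeasure_contaminatedGaussian {p : ℕ} {ε : ℝ} (hε0 : 0 ≤ ε) (hε1 : ε ≤ 1)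
    (θ : EuclideanSpace ℝ (Fin p)) (Q : Measure (EuclideanSpace ℝ (Fin p)))
    [IsProbabilityMeasure Q] : IsProbabilityMeasure (contaminatedGaussian ε θ Q) := by
  constructor
  simp [contaminatedGaussian, ← ENNReal.ofReal_add (sub_nonneg.2 hε1) hε0]

/-- The empirical mass of a half-space is the proportion of sample points in it. -/
theorem empiricalDistribution_real_halfspace {p n : ℕ} (X : Fin n → EuclideanSpace ℝ (Fin p))
    (u : EuclideanSpace ℝ (Fin p)) (t : ℝ) :
    (empiricalDistribution X).real {x | ⟪u, x⟫ ≤ t} =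
      (1 / (n : ℝ)) * ∑ i : Fin n, Set.indicator {x | ⟪u, x⟫ ≤ t} (fun _ => (1 : ℝ)) (X i) := by
  have hm : MeasurableSet {x : EuclideanSpace ℝ (Fin p) | ⟪u, x⟫ ≤ t} :=
    measurableSet_le (by fun_prop) measurable_const
  simp only [Measure.real, empiricalDistribution, Measure.smul_apply, Measure.finsetSum_apply,
    smul_eq_mul, ENNReal.toReal_mul, Measure.dirac_apply' _ hm]
  rw [ENNReal.toReal_sum]
  · simp only [ENNReal.toReal_inv, ENNReal.toReal_natCast, one_div]
    congr 1
    refine Finset.sum_congr rfl fun i _ => ?_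
    by_cases h : X i ∈ {x : EuclideanSpace ℝ (Fin p) | ⟪u, x⟫ ≤ t} <;> simp [Set.indicator, h]
  · intro i _
    by_cases h : X i ∈ {x : EuclideanSpace ℝ (Fin p) | ⟪u, x⟫ ≤ t} <;> simp [Set.indicator, h]

/-- Every sample has a Tukey median: the empirical depth takes only finitely many values. -/
theorem exists_isTukeyMedian {p n : ℕ} (X : Fin n → EuclideanSpace ℝ (Fin p)) :
    ∃ θhat, IsTukeyMedian X θhat := by
  classical
  set V : Set ℝ := Set.range fun s : Finset (Fin n) => (1 / (n : ℝ)) * (s.card : ℝ)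
  have hV : V.Finite := Set.finite_range _
  have hmem : ∀ η, tukeyDepth η (empiricalDistribution X) ∈ V := by
    intro η
    set f : Metric.sphere (0 : EuclideanSpace ℝ (Fin p)) 1 → ℝ := fun u =>
      (empiricalDistribution X).real
        {x | ⟪(u : EuclideanSpace ℝ (Fin p)), x⟫ ≤ ⟪(u : EuclideanSpace ℝ (Fin p)), η⟫} with hf
    have hsub : Set.range f ⊆ V := by
      rintro _ ⟨u, rfl⟩
      refine ⟨Finset.univ.filter fun i =>
        ⟪(u : EuclideanSpace ℝ (Fin p)), X i⟫ ≤ ⟪(u : EuclideanSpace ℝ (Fin p)), η⟫, ?_⟩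
      simp only [hf, empiricalDistribution_real_halfspace]
      simp [Set.indicator_apply]
    change iInf f ∈ V
    rcases isEmpty_or_nonempty (Metric.sphere (0 : EuclideanSpace ℝ (Fin p)) 1) with h | h
    · rw [Real.iInf_of_isEmpty]
      exact ⟨∅, by simp⟩
    · exact hsub ((Set.range_nonempty f).csInf_mem (hV.subset hsub))
  have hfin : (Set.range fun η => tukeyDepth η (empiricalDistribution X)).Finite :=
    hV.subset (by rintro _ ⟨η, rfl⟩; exact hmem η)
  obtain ⟨_, ⟨θhat, rfl⟩, h⟩ := hfin.exists_maximal (Set.range_nonempty _)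
  refine ⟨θhat, fun η => ?_⟩
  by_contra hlt
  exact hlt (h ⟨η, rfl⟩ (not_le.1 hlt).le)

end

/-! Write G for the standard normal law. Suppose that, uniformly over unit vectors `u`, at most a
fraction (1 - ε) G(t, ∞) + ε + 66δ of the sample lies in the open half-space `{t < ⟪u, x - θ⟫}`, for
t = 0 and t = r. The bound at t = 0 makes the empirical depth of θ at least (1 - ε)/2 - 66δ. The
bound at t = r caps the depth of every point farther than r from θ, since such a point lies on a
closed half-space contained in one of these. As G(r, ∞) ≤ 1/2 - 4r/27 for r ≤ 3, a maximizer of the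
depth farther than r would force (1 - ε) 4r/27 ≤ ε + 132δ, which fails for r = 9(ε + 132δ) because ε
< 1/4. Only upper bounds on half-space counts, at two fixed levels, are needed.

To obtain them, each observation is given a hidden label, clean or contaminated. Contaminated
points, whatever Q is, count at most once each, and Bernstein's inequality controls their number.
For clean points, `HasGaussianMarginalsOn.measureReal_pi_uniform` gives the deviation 60δ by
chaining over nets of the sphere. Half-spaces with normals 16^(-k) apart differ on a set of mass of
order 4^(-k), so the Bernstein errors decrease geometrically and no logarithmic factor appears. The
last link, from a net to an arbitrary direction, uses an operator norm bound on the clean points.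
Only one-dimensional Gaussian marginals enter. -/

/-! ### Nets of the unit sphere by volume comparison. -/

section Nets

variable {E : Type*} [NormedAddCommGroup E] [NormedSpace ℝ E] [FiniteDimensional ℝ E]

/-- Volume bound for the size of a separated subset of the unit ball. -/
theorem card_le_of_separated_unitBall {ρ : ℝ} (hρ : 0 < ρ) (hρ1 : ρ ≤ 1) (s : Finset E)
    (hs : ∀ c ∈ s, ‖c‖ ≤ 1) (h : ∀ c ∈ s, ∀ d ∈ s, c ≠ d → ρ ≤ ‖c - d‖) :
    (s.card : ℝ) ≤ (3 / ρ) ^ Module.finrank ℝ E := by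
  borelize E
  let μ : Measure E := Measure.addHaar
  have D : Set.Pairwise (s : Set E)
      (Function.onFun Disjoint fun c => Metric.ball (c : E) (ρ / 2)) := by
    rintro c hc d hd hcd
    apply Metric.ball_disjoint_ball
    rw [dist_eq_norm]
    linarith [h c hc d hd hcd]
  have hsub : (⋃ c ∈ s, Metric.ball (c : E) (ρ / 2)) ⊆ Metric.ball (0 : E) (3 / 2) := by
    refine Set.iUnion₂_subset fun x hx => Metric.ball_subset_ball' ?_
    rw [dist_zero_right]
    linarith [hs x hx]
  have I : (s.card : ℝ≥0∞) * ENNReal.ofReal ((ρ / 2) ^ Module.finrank ℝ E) *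
      μ (Metric.ball 0 1) ≤
      ENNReal.ofReal ((3 / 2) ^ Module.finrank ℝ E) * μ (Metric.ball 0 1) :=
    calc
      _ = μ (⋃ c ∈ s, Metric.ball (c : E) (ρ / 2)) := by
        rw [measure_biUnion_finset D fun c _ => measurableSet_ball]
        simp only [μ.addHaar_ball_of_pos _ (half_pos hρ)]
        simp only [Finset.sum_const, nsmul_eq_mul, mul_assoc]
      _ ≤ μ (Metric.ball (0 : E) (3 / 2)) := measure_mono hsub
      _ = _ := by
        simp only [μ.addHaar_ball_of_pos _ (show (0 : ℝ) < 3 / 2 by norm_num)]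
  have J := (ENNReal.mul_le_mul_iff_left (Metric.measure_ball_pos μ (0 : E) zero_lt_one).ne'
    measure_ball_lt_top.ne).1 I
  have K := ENNReal.toReal_le_of_le_ofReal (by positivity) J
  rw [ENNReal.toReal_mul, ENNReal.toReal_natCast, ENNReal.toReal_ofReal (by positivity)] at K
  have hpos : 0 < (ρ / 2) ^ Module.finrank ℝ E := by positivity
  rw [← le_div_iff₀ hpos, ← div_pow] at K
  have e : (3 / 2 : ℝ) / (ρ / 2) = 3 / ρ := by field_simp
  rwa [e] at K

/-- A finite `ρ`-net of the unit sphere with at most `(3 / ρ) ^ dim` points. -/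
theorem exists_sphere_net {ρ : ℝ} (hρ : 0 < ρ) (hρ1 : ρ ≤ 1) :
    ∃ s : Finset E, (∀ a ∈ s, ‖a‖ = 1) ∧ (∀ u : E, ‖u‖ = 1 → ∃ a ∈ s, ‖u - a‖ ≤ ρ) ∧
      (s.card : ℝ) ≤ (3 / ρ) ^ Module.finrank ℝ E := by
  classical
  -- Separated families have bounded cardinality, so one of maximal size exists. It is a net, since
  -- a point far from all its members could be added.
  let T : Set ℕ := {k | ∃ s : Finset E, (∀ a ∈ s, ‖a‖ = 1) ∧
    (∀ c ∈ s, ∀ d ∈ s, c ≠ d → ρ ≤ ‖c - d‖) ∧ s.card = k}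
  have hbound : ∀ k ∈ T, k ≤ ⌊(3 / ρ) ^ Module.finrank ℝ E⌋₊ := by
    rintro k ⟨s, hs, hsep, rfl⟩
    exact Nat.le_floor (card_le_of_separated_unitBall hρ hρ1 s (fun c hc => (hs c hc).le) hsep)
  have hne : T.Nonempty := ⟨0, ∅, by simp, by simp, rfl⟩
  have hmem : sSup T ∈ T := Nat.sSup_mem hne ⟨_, hbound⟩
  obtain ⟨s, hs, hsep, hcard⟩ := hmem
  refine ⟨s, hs, fun u hu => ?_,
    card_le_of_separated_unitBall hρ hρ1 s (fun c hc => (hs c hc).le) hsep⟩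
  by_contra! hfar
  have hus : u ∉ s := fun h => by
    have := hfar u h
    simp at this
    linarith
  have hin : s.card + 1 ∈ T := by
    refine ⟨insert u s, ?_, ?_, Finset.card_insert_of_notMem hus⟩
    · intro a ha
      rcases Finset.mem_insert.1 ha with rfl | ha
      exacts [hu, hs a ha]
    · intro c hc d hd hcd
      rcases Finset.mem_insert.1 hc with rfl | hc' <;>
        rcases Finset.mem_insert.1 hd with rfl | hd'
      · exact absurd rfl hcd
      · exact (hfar d hd').le
      · rw [norm_sub_rev]; exact (hfar c hc').le
      · exact hsep c hc' d hd' hcd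
  have := le_csSup ⟨_, hbound⟩ hin
  omega

end Nets

/-! ### Exponential inequalities for independent sums. -/

section Concentration

variable {Ω : Type*} [MeasurableSpace Ω]

/-- Exponential Markov inequality for sums of functions of independent coordinates. -/
theorem measureReal_pi_le_sum_le (μ : Measure Ω) [IsProbabilityMeasure μ] {h : Ω → ℝ}
    (hi : Integrable (fun ω => Real.exp (h ω)) μ) {a : ℝ}
    (ha : ∫ ω, Real.exp (h ω) ∂μ ≤ Real.exp a) (n : ℕ) (b : ℝ) :
    (Measure.pi fun _ : Fin n => μ).real {ω | b ≤ ∑ i, h (ω i)} ≤ Real.exp (n * a - b) := by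
  have hint : Integrable (fun ω : Fin n → Ω => ∏ i, Real.exp (h (ω i)))
      (Measure.pi fun _ : Fin n => μ) := Integrable.fintype_prod fun _ => hi
  have hmark := mul_meas_ge_le_integral_of_nonneg
    (Filter.Eventually.of_forall fun ω => Finset.prod_nonneg fun i _ => (Real.exp_pos _).le)
    hint (Real.exp b)
  have hprod : ∫ ω : Fin n → Ω, ∏ i, Real.exp (h (ω i)) ∂(Measure.pi fun _ : Fin n => μ) ≤
      Real.exp (n * a) := by
    rw [integral_fintype_prod_eq_prod (f := fun _ ω => Real.exp (h ω)), Finset.prod_const,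
      Finset.card_univ, Fintype.card_fin, Real.exp_nat_mul]
    exact pow_le_pow_left₀ (integral_nonneg fun _ => (Real.exp_pos _).le) ha n
  have hset : {ω : Fin n → Ω | Real.exp b ≤ ∏ i, Real.exp (h (ω i))} =
      {ω | b ≤ ∑ i, h (ω i)} := by
    ext ω
    simp [← Real.exp_sum]
  rw [hset] at hmark
  rw [Real.exp_sub, le_div_iff₀ (Real.exp_pos b), mul_comm]
  exact hmark.trans hprod

/-- A Bernstein-type bound for sums of bounded functions of independent coordinates. -/
theorem measureReal_pi_bernstein (μ : Measure Ω) [IsProbabilityMeasure μ] {D : Ω → ℝ}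
    (hD : Measurable D) (hD1 : ∀ ω, |D ω| ≤ 1) {m q l : ℝ} (hm : ∫ ω, D ω ∂μ ≤ m)
    (hq : ∫ ω, D ω ^ 2 ∂μ ≤ q) (hl : 0 < l) (hl1 : l ≤ 1) (n : ℕ) (x : ℝ) :
    (Measure.pi fun _ : Fin n => μ).real {ω | n * (m + q * l) + x / l ≤ ∑ i, D (ω i)} ≤
      Real.exp (-x) := by
  have hlD : ∀ ω, |l * D ω| ≤ 1 := fun ω => by
    rw [abs_mul, abs_of_pos hl]
    exact mul_le_one₀ hl1 (abs_nonneg _) (hD1 ω)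
  have hiD : Integrable D μ := Integrable.of_bound hD.aestronglyMeasurable 1
    (Filter.Eventually.of_forall hD1)
  have hiD2 : Integrable (fun ω => D ω ^ 2) μ :=
    Integrable.of_bound (hD.pow_const 2).aestronglyMeasurable 1
      (Filter.Eventually.of_forall fun ω => by
        rw [Real.norm_eq_abs, abs_pow]
        exact pow_le_one₀ (abs_nonneg _) (hD1 ω))
  have hie : Integrable (fun ω => Real.exp (l * D ω)) μ :=
    Integrable.of_bound (by fun_prop) (Real.exp 1) (Filter.Eventually.of_forall fun ω => by
      rw [Real.norm_eq_abs, abs_of_pos (Real.exp_pos _)]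
      exact Real.exp_le_exp.2 ((le_abs_self _).trans (hlD ω)))
  have hmgf : ∫ ω, Real.exp (l * D ω) ∂μ ≤ Real.exp (l * m + l ^ 2 * q) := by
    calc ∫ ω, Real.exp (l * D ω) ∂μ ≤ ∫ ω, (1 + l * D ω + l ^ 2 * D ω ^ 2) ∂μ := by
          refine integral_mono hie (((integrable_const _).add (hiD.const_mul l)).add
            (hiD2.const_mul _)) fun ω => ?_
          -- This is exp y ≤ 1 + y + y² for |y| ≤ 1, which is why `l ≤ 1` is required.
          have := (abs_le.1 (Real.abs_exp_sub_one_sub_id_le (hlD ω))).2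
          simp only
          nlinarith
      _ = 1 + l * ∫ ω, D ω ∂μ + l ^ 2 * ∫ ω, D ω ^ 2 ∂μ := by
          rw [integral_add (f := fun ω => 1 + l * D ω)
              ((integrable_const _).add (hiD.const_mul l)) (hiD2.const_mul _),
            integral_add (integrable_const _) (hiD.const_mul l), integral_const_mul,
            integral_const_mul]
          simp
      _ ≤ l * m + l ^ 2 * q + 1 := by
          have := mul_le_mul_of_nonneg_left hm hl.le
          have := mul_le_mul_of_nonneg_left hq (sq_nonneg l)
          linarith
      _ ≤ Real.exp (l * m + l ^ 2 * q) := Real.add_one_le_exp _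
  have := measureReal_pi_le_sum_le μ hie hmgf n (l * (n * (m + q * l) + x / l))
  have e : n * (l * m + l ^ 2 * q) - l * (n * (m + q * l) + x / l) = -x := by
    field_simp
    ring
  rw [e] at this
  convert this using 3
  ext ω
  rw [← Finset.mul_sum, mul_le_mul_iff_right₀ hl]

/-- Union bound over a finite family of events of exponentially small probability. -/
theorem measureReal_biUnion_le_exp {ι : Type*} (P : Measure Ω) [IsFiniteMeasure P] (s : Finset ι)
    (B : ι → Set Ω) {x y : ℝ} (hB : ∀ a ∈ s, P.real (B a) ≤ Real.exp (-x))
    (hs : (s.card : ℝ) ≤ Real.exp y) : P.real (⋃ a ∈ s, B a) ≤ Real.exp (y - x) := by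
  calc P.real (⋃ a ∈ s, B a) ≤ ∑ a ∈ s, P.real (B a) := measureReal_biUnion_finset_le s B
    _ ≤ s.card • Real.exp (-x) := Finset.sum_le_card_nsmul s _ _ hB
    _ ≤ Real.exp y * Real.exp (-x) := by
        rw [nsmul_eq_mul]
        exact mul_le_mul_of_nonneg_right hs (Real.exp_pos _).le
    _ = Real.exp (y - x) := by rw [← Real.exp_add, sub_eq_add_neg]

end Concentration

/-! ### Estimates for the standard normal law. -/

section StandardNormal

theorem gaussianPDFReal_zero_one_le_half (x : ℝ) : gaussianPDFReal 0 1 x ≤ 1 / 2 := by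
  have h2 : (2 : ℝ) ≤ √(2 * Real.pi) := by
    rw [Real.le_sqrt (by norm_num) (by positivity)]
    nlinarith [Real.pi_gt_three]
  have he : Real.exp (-x ^ 2 / 2) ≤ 1 := Real.exp_le_one_iff.2 (by nlinarith [sq_nonneg x])
  simp only [gaussianPDFReal, NNReal.coe_one, mul_one, sub_zero]
  calc (√(2 * Real.pi))⁻¹ * Real.exp (-x ^ 2 / 2) ≤ (2 : ℝ)⁻¹ * 1 := by gcongr
    _ = 1 / 2 := by norm_num

theorem gaussianReal_real_eq_setIntegral (s : Set ℝ) :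
    (gaussianReal 0 1).real s = ∫ x in s, gaussianPDFReal 0 1 x := by
  rw [Measure.real, gaussianReal_apply_eq_integral 0 one_ne_zero,
    ENNReal.toReal_ofReal (integral_nonneg fun x => gaussianPDFReal_nonneg 0 1 x)]

theorem gaussianReal_real_abs_sub_le {s : ℝ} (hs : 0 ≤ s) (t : ℝ) :
    (gaussianReal 0 1).real {x | |x - t| ≤ s} ≤ s := by
  have hset : {x : ℝ | |x - t| ≤ s} = Set.Icc (t - s) (t + s) := by
    ext x
    simp only [Set.mem_ofPred_eq, Set.mem_Icc, abs_le]
    constructor <;> rintro ⟨h1, h2⟩ <;> constructor <;> linarith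
  rw [hset, gaussianReal_real_eq_setIntegral]
  calc ∫ x in Set.Icc (t - s) (t + s), gaussianPDFReal 0 1 x
      ≤ ∫ x in Set.Icc (t - s) (t + s), (1 / 2 : ℝ) :=
        setIntegral_mono (integrable_gaussianPDFReal 0 1).integrableOn (by simp)
          gaussianPDFReal_zero_one_le_half
    _ = s := by
        rw [setIntegral_const, Real.volume_real_Icc_of_le (by linarith), smul_eq_mul]
        ring

theorem gaussianReal_real_lt_abs_le (v : NNReal) {s : ℝ} (hs : 0 < s) :
    (gaussianReal 0 v).real {x | s < |x|} ≤ v / s ^ 2 := by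
  have h := meas_ge_le_variance_div_sq (μ := gaussianReal 0 v)
    (memLp_id_gaussianReal (μ := 0) (v := v) 2) hs
  simp only [id_eq, integral_id_gaussianReal, sub_zero, variance_id_gaussianReal] at h
  calc (gaussianReal 0 v).real {x | s < |x|} ≤ (gaussianReal 0 v).real {x | s ≤ |x|} :=
        measureReal_mono fun x (hx : s < |x|) => hx.le
    _ ≤ v / s ^ 2 := ENNReal.toReal_le_of_le_ofReal (by positivity) h

theorem gaussianReal_real_Ioi_zero : (gaussianReal 0 1).real (Set.Ioi 0) = 1 / 2 := by
  have := nullSingletonClass_gaussianReal (μ := 0) (v := 1) one_ne_zero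
  have hneg : (gaussianReal 0 1).real (Set.Iio 0) = (gaussianReal 0 1).real (Set.Ioi 0) := by
    conv_rhs => rw [← neg_zero, ← gaussianReal_map_neg]
    rw [map_measureReal_apply measurable_neg measurableSet_Ioi]
    simp
  have hu : (gaussianReal 0 1).real (Set.Iic 0) + (gaussianReal 0 1).real (Set.Ioi 0) = 1 := by
    rw [← measureReal_union (by simp [Set.disjoint_left]) measurableSet_Ioi, Set.Iic_union_Ioi,
      probReal_univ]
  rw [← measureReal_congr Iio_ae_eq_Iic, hneg] at hu
  linarith

theorem gaussianPDFReal_zero_one_antitoneOn : AntitoneOn (gaussianPDFReal 0 1) (Set.Ici 0) := by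
  intro x hx y _ hxy
  simp only [gaussianPDFReal, NNReal.coe_one, mul_one, sub_zero]
  have : x ^ 2 ≤ y ^ 2 := pow_le_pow_left₀ hx hxy 2
  gcongr

/-- Linear lower bound, by concavity, for the mass of a standard normal variable to the right of
its median. -/
theorem gaussianReal_real_Ioi_le {r : ℝ} (hr : 0 ≤ r) (hr3 : r ≤ 3) :
    (gaussianReal 0 1).real (Set.Ioi r) ≤ 1 / 2 - 4 / 27 * r := by
  set G := gaussianReal 0 1 with hG
  set φ := gaussianPDFReal 0 1
  have hsplit : ∀ a b : ℝ, a ≤ b → G.real (Set.Ioc a b) + G.real (Set.Ioi b) =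
      G.real (Set.Ioi a) := fun a b hab => by
    rw [← measureReal_union (by simp +contextual [Set.disjoint_left]) measurableSet_Ioi,
      Set.Ioc_union_Ioi_eq_Ioi hab]
  -- The density decreases on [0, ∞), so eliminating `φ r` between `hlow` and `hup` shows that (0,
  -- r] has at least r/3 of the mass of (0, 3]. By Chebyshev and symmetry the latter is at least 1/2
  -- - 1/18 = 4/9, whence the slope 4/27.
  have hlow : r * φ r ≤ G.real (Set.Ioc 0 r) := by
    rw [hG, gaussianReal_real_eq_setIntegral]
    calc r * φ r = ∫ x in Set.Ioc 0 r, φ r := by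
          rw [setIntegral_const, Real.volume_real_Ioc_of_le hr, smul_eq_mul, sub_zero]
      _ ≤ ∫ x in Set.Ioc 0 r, φ x :=
          setIntegral_mono_on (by simp) (integrable_gaussianPDFReal 0 1).integrableOn
            measurableSet_Ioc fun x hx =>
              gaussianPDFReal_zero_one_antitoneOn hx.1.le hr hx.2
  have hup : G.real (Set.Ioc r 3) ≤ (3 - r) * φ r := by
    rw [hG, gaussianReal_real_eq_setIntegral]
    calc ∫ x in Set.Ioc r 3, φ x ≤ ∫ x in Set.Ioc r 3, φ r :=
          setIntegral_mono_on (integrable_gaussianPDFReal 0 1).integrableOn (by simp)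
            measurableSet_Ioc fun x hx =>
              gaussianPDFReal_zero_one_antitoneOn hr (hr.trans hx.1.le) hx.1.le
      _ = (3 - r) * φ r := by
          rw [setIntegral_const, Real.volume_real_Ioc_of_le hr3, smul_eq_mul]
  have htail : 2 * G.real (Set.Ioi 3) ≤ 1 / 9 := by
    have h := gaussianReal_real_lt_abs_le 1 (show (0 : ℝ) < 3 by norm_num)
    have hneg : G.real (Set.Iio (-3)) = G.real (Set.Ioi 3) := by
      conv_rhs => rw [hG, ← neg_zero, ← gaussianReal_map_neg]
      rw [map_measureReal_apply measurable_neg measurableSet_Ioi]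
      simp [hG]
    have hset : {x : ℝ | 3 < |x|} = Set.Iio (-3) ∪ Set.Ioi 3 := by
      ext x
      simp only [Set.mem_ofPred_eq, lt_abs, Set.mem_union, Set.mem_Iio, Set.mem_Ioi]
      constructor <;> rintro (h | h) <;> [right; left; right; left] <;> linarith
    have hdisj : Disjoint (Set.Iio (-3 : ℝ)) (Set.Ioi 3) :=
      Set.disjoint_left.2 fun x (h1 : x < -3) (h2 : 3 < x) => by linarith
    rw [hset, measureReal_union hdisj measurableSet_Ioi, ← hG, hneg] at h
    norm_num at h
    linarith
  have h0 := hsplit 0 r hr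
  have h3 := hsplit r 3 hr3
  rw [hG, gaussianReal_real_Ioi_zero, ← hG] at h0
  have e1 : (3 - r) * (r * φ r) ≤ (3 - r) * G.real (Set.Ioc 0 r) :=
    mul_le_mul_of_nonneg_left hlow (by linarith)
  have e2 := mul_le_mul_of_nonneg_left hup hr
  have e3 := mul_le_mul_of_nonneg_left htail hr
  nlinarith

/-- The integrand against Lebesgue measure is again Gaussian, of variance 2, and the exact value is
√2. -/
theorem integrable_exp_sq_div_four_gaussianReal :
    Integrable (fun x => Real.exp (x ^ 2 / 4)) (gaussianReal 0 1) ∧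
      ∫ x, Real.exp (x ^ 2 / 4) ∂(gaussianReal 0 1) ≤ 2 := by
  have hpt : ∀ x : ℝ, gaussianPDFReal 0 1 x * Real.exp (x ^ 2 / 4) =
      (√(2 * Real.pi))⁻¹ * Real.exp (-(1 / 4) * x ^ 2) := fun x => by
    simp only [gaussianPDFReal, NNReal.coe_one, mul_one, sub_zero]
    rw [mul_assoc, ← Real.exp_add]
    ring_nf
  constructor
  · rw [gaussianReal_of_var_ne_zero 0 one_ne_zero,
      integrable_withDensity_iff_integrable_smul' (measurable_gaussianPDF 0 1)
        (Filter.Eventually.of_forall fun _ => gaussianPDF_lt_top)]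
    simp only [toReal_gaussianPDF, smul_eq_mul, hpt]
    exact (integrable_exp_neg_mul_sq (by norm_num)).const_mul _
  · rw [integral_gaussianReal_eq_integral_smul one_ne_zero]
    simp only [smul_eq_mul, hpt]
    rw [integral_const_mul, integral_gaussian]
    have : Real.pi / (1 / 4) = 2 * (2 * Real.pi) := by ring
    rw [this, Real.sqrt_mul (by norm_num) (2 * Real.pi), mul_comm, mul_assoc,
      mul_inv_cancel₀ (by positivity), mul_one, Real.sqrt_le_left (by norm_num)]
    norm_num

end StandardNormal

/-! ### From a net to the whole sphere for quadratic forms. -/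

section OperatorNorm

variable {E : Type*} [NormedAddCommGroup E] [InnerProductSpace ℝ E]

/-- A quadratic form `∑ ⟪w, y i⟫ ^ 2` is controlled by its values on a `1/2`-net of the sphere. -/
theorem sum_inner_sq_le_of_net {ι : Type*} [Fintype ι] (y : ι → E) (s : Set E)
    (hs : ∀ u : E, ‖u‖ = 1 → ∃ a ∈ s, ‖u - a‖ ≤ 1 / 2) {b : ℝ}
    (hb : ∀ a ∈ s, ∑ i, ⟪a, y i⟫ ^ 2 ≤ b) (w : E) :
    ∑ i, ⟪w, y i⟫ ^ 2 ≤ 4 * b * ‖w‖ ^ 2 := by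
  rcases eq_or_ne w 0 with rfl | hw
  · simp
  have hb0 : 0 ≤ b := by
    obtain ⟨a, ha, -⟩ := hs (‖w‖⁻¹ • w) (norm_smul_inv_norm hw)
    exact (Finset.sum_nonneg fun i _ => sq_nonneg _).trans (hb a ha)
  let L : E →L[ℝ] EuclideanSpace ℝ ι :=
    (EuclideanSpace.equiv ι ℝ).symm.toContinuousLinearMap ∘L
      ContinuousLinearMap.pi fun i => innerSL ℝ (y i)
  have hL : ∀ v, ‖L v‖ ^ 2 = ∑ i, ⟪v, y i⟫ ^ 2 := fun v => by
    rw [EuclideanSpace.real_norm_sq_eq]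
    refine Finset.sum_congr rfl fun i _ => ?_
    rw [real_inner_comm]
    rfl
  have hLb : ∀ a ∈ s, ‖L a‖ ≤ √b := fun a ha =>
    Real.le_sqrt_of_sq_le ((hL a).trans_le (hb a ha))
  -- The error of replacing a unit vector by a net point costs half of `‖L‖`, which is then absorbed
  -- on the left.
  have hop : ‖L‖ ≤ √b + ‖L‖ * (1 / 2) := by
    refine ContinuousLinearMap.opNorm_le_of_unit_norm (by positivity) fun u hu => ?_
    obtain ⟨a, ha, hua⟩ := hs u hu
    calc ‖L u‖ = ‖L a + L (u - a)‖ := by rw [← map_add]; simp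
      _ ≤ ‖L a‖ + ‖L (u - a)‖ := norm_add_le _ _
      _ ≤ √b + ‖L‖ * (1 / 2) := add_le_add (hLb a ha)
          ((L.le_opNorm _).trans (mul_le_mul_of_nonneg_left hua (norm_nonneg _)))
  have hop2 : ‖L‖ ≤ 2 * √b := by linarith
  rw [← hL]
  calc ‖L w‖ ^ 2 ≤ (2 * √b * ‖w‖) ^ 2 :=
        pow_le_pow_left₀ (norm_nonneg _) ((L.le_opNorm w).trans
          (mul_le_mul_of_nonneg_right hop2 (norm_nonneg _))) 2
    _ = 4 * b * ‖w‖ ^ 2 := by rw [mul_pow, mul_pow, Real.sq_sqrt hb0]; ring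

end OperatorNorm

/-! ### Deviation bounds from one-dimensional Gaussian marginals. -/

section Marginals

variable {E : Type*} [NormedAddCommGroup E] [InnerProductSpace ℝ E]
  {Ω : Type*} [MeasurableSpace Ω]

/-- Under `μ`, restricted to the event `S`, the random vector `Y` has the one-dimensional
marginals of `α` times the standard Gaussian measure. -/
structure HasGaussianMarginalsOn (μ : Measure Ω) (S : Set Ω) (Y : Ω → E) (α : ℝ) : Prop where
  nonneg : 0 ≤ α
  le_one : α ≤ 1
  measurableSet : MeasurableSet S
  measurable_inner : ∀ u : E, Measurable fun ω => ⟪u, Y ω⟫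
  map_inner : ∀ u : E, (μ.restrict S).map (fun ω => ⟪u, Y ω⟫) =
    ENNReal.ofReal α • gaussianReal 0 (‖u‖₊ ^ 2)

variable {μ : Measure Ω} {S : Set Ω} {Y : Ω → E} {α : ℝ}

namespace HasGaussianMarginalsOn

theorem measureReal_inter (h : HasGaussianMarginalsOn μ S Y α) (u : E) {B : Set ℝ}
    (hB : MeasurableSet B) :
    μ.real (S ∩ {ω | ⟪u, Y ω⟫ ∈ B}) = α * (gaussianReal 0 (‖u‖₊ ^ 2)).real B := by
  have hm : MeasurableSet {ω | ⟪u, Y ω⟫ ∈ B} := h.measurable_inner u hB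
  have e : (μ.restrict S).map (fun ω => ⟪u, Y ω⟫) B = μ (S ∩ {ω | ⟪u, Y ω⟫ ∈ B}) := by
    rw [Measure.map_apply (h.measurable_inner u) hB, Set.inter_comm,
      ← Measure.restrict_apply hm]
    rfl
  rw [Measure.real, ← e, h.map_inner u, Measure.smul_apply, smul_eq_mul, ENNReal.toReal_mul,
    ENNReal.toReal_ofReal h.nonneg, Measure.real]

theorem measurableSet_inter_lt (h : HasGaussianMarginalsOn μ S Y α) (u : E) (t : ℝ) :
    MeasurableSet (S ∩ {ω | t < ⟪u, Y ω⟫}) :=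
  h.measurableSet.inter (measurableSet_lt measurable_const (h.measurable_inner u))

theorem measureReal_inter_lt (h : HasGaussianMarginalsOn μ S Y α) {u : E} (hu : ‖u‖ = 1)
    (t : ℝ) :
    μ.real (S ∩ {ω | t < ⟪u, Y ω⟫}) = α * (gaussianReal 0 1).real (Set.Ioi t) := by
  have hu' : ‖u‖₊ = 1 := NNReal.eq hu
  simpa [hu'] using h.measureReal_inter u (measurableSet_Ioi (a := t))

theorem measureReal_inter_abs_sub_le (h : HasGaussianMarginalsOn μ S Y α) {u : E}
    (hu : ‖u‖ = 1) {s : ℝ} (hs : 0 ≤ s) (t : ℝ) :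
    μ.real (S ∩ {ω | |⟪u, Y ω⟫ - t| ≤ s}) ≤ s := by
  have hu' : ‖u‖₊ = 1 := NNReal.eq hu
  have := h.measureReal_inter u (B := {x | |x - t| ≤ s})
    (measurableSet_le (by fun_prop) measurable_const)
  rw [hu', one_pow] at this
  refine this.trans_le ?_
  calc α * (gaussianReal 0 1).real {x | |x - t| ≤ s} ≤ 1 * s :=
        mul_le_mul h.le_one (gaussianReal_real_abs_sub_le hs t) measureReal_nonneg zero_le_one
    _ = s := one_mul s

theorem measureReal_inter_lt_abs_le (h : HasGaussianMarginalsOn μ S Y α) (w : E) {s : ℝ}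
    (hs : 0 < s) : μ.real (S ∩ {ω | s < |⟪w, Y ω⟫|}) ≤ ‖w‖ ^ 2 / s ^ 2 := by
  have := h.measureReal_inter w (B := {x | s < |x|})
    (measurableSet_lt measurable_const (by fun_prop))
  refine this.trans_le ?_
  calc α * (gaussianReal 0 (‖w‖₊ ^ 2)).real {x | s < |x|} ≤ 1 * (‖w‖ ^ 2 / s ^ 2) :=
        mul_le_mul h.le_one (gaussianReal_real_lt_abs_le (‖w‖₊ ^ 2) hs)
          measureReal_nonneg zero_le_one
    _ = ‖w‖ ^ 2 / s ^ 2 := one_mul _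

theorem measureReal_eq (h : HasGaussianMarginalsOn μ S Y α) : μ.real S = α := by
  simpa using h.measureReal_inter 0 MeasurableSet.univ

variable [IsProbabilityMeasure μ]

/-- Off `S` the truncated vector is zero and the exponential is 1, so the integral is at most 2α +
(1 - α) ≤ 2. -/
theorem integrable_exp_inner_sq (h : HasGaussianMarginalsOn μ S Y α) {u : E} (hu : ‖u‖ = 1) :
    Integrable (fun ω => Real.exp (⟪u, S.indicator Y ω⟫ ^ 2 / 4)) μ ∧
      ∫ ω, Real.exp (⟪u, S.indicator Y ω⟫ ^ 2 / 4) ∂μ ≤ 2 := by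
  have hu' : ‖u‖₊ = 1 := NNReal.eq hu
  obtain ⟨hi, hle⟩ := integrable_exp_sq_div_four_gaussianReal
  have hmap := h.map_inner u
  rw [hu', one_pow] at hmap
  have hiS : IntegrableOn (fun ω => Real.exp (⟪u, Y ω⟫ ^ 2 / 4)) S μ := by
    have : Integrable (fun x => Real.exp (x ^ 2 / 4))
        ((μ.restrict S).map (fun ω => ⟪u, Y ω⟫)) := by
      rw [hmap]
      exact hi.smul_measure ENNReal.ofReal_ne_top
    exact this.comp_measurable (h.measurable_inner u)
  have hval : ∫ ω in S, Real.exp (⟪u, Y ω⟫ ^ 2 / 4) ∂μ ≤ α * 2 := by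
    have := integral_map (μ := μ.restrict S) (h.measurable_inner u).aemeasurable
      (f := fun x : ℝ => Real.exp (x ^ 2 / 4)) (by fun_prop)
    rw [← this, hmap, integral_smul_measure, ENNReal.toReal_ofReal h.nonneg, smul_eq_mul]
    exact mul_le_mul_of_nonneg_left hle h.nonneg
  have hsplit : (fun ω => Real.exp (⟪u, S.indicator Y ω⟫ ^ 2 / 4)) =
      S.indicator (fun ω => Real.exp (⟪u, Y ω⟫ ^ 2 / 4)) + Sᶜ.indicator 1 := by
    ext ω
    by_cases hω : ω ∈ S <;> simp [hω]
  have hi1 := hiS.integrable_indicator h.measurableSet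
  have hi2 : Integrable (Sᶜ.indicator (1 : Ω → ℝ)) μ :=
    (integrable_const (1 : ℝ)).indicator h.measurableSet.compl
  rw [hsplit]
  refine ⟨hi1.add hi2, ?_⟩
  rw [integral_add' hi1 hi2, integral_indicator h.measurableSet,
    integral_indicator_one h.measurableSet.compl, probReal_compl_eq_one_sub h.measurableSet,
    h.measureReal_eq]
  linarith [h.le_one]

end HasGaussianMarginalsOn

variable [IsProbabilityMeasure μ]

theorem measureReal_pi_indicator_bernstein (T : Set Ω) (hT : MeasurableSet T) {q l : ℝ}
    (hq : μ.real T ≤ q) (hl : 0 < l) (hl1 : l ≤ 1) (n : ℕ) (x : ℝ) :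
    (Measure.pi fun _ : Fin n => μ).real
      {ω | n * (μ.real T + q * l) + x / l ≤ ∑ i, T.indicator (1 : Ω → ℝ) (ω i)} ≤
        Real.exp (-x) := by
  refine measureReal_pi_bernstein μ (measurable_one.indicator hT) (fun ω => ?_)
    (integral_indicator_one hT).le ?_ hl hl1 n x
  · by_cases hω : ω ∈ T <;> simp [hω]
  · have : (fun ω => T.indicator (1 : Ω → ℝ) ω ^ 2) = T.indicator 1 := by
      ext ω
      by_cases hω : ω ∈ T <;> simp [hω]
    rw [this, integral_indicator_one hT]
    exact hq

namespace HasGaussianMarginalsOn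

/-- Deviation of the difference of the empirical masses of two close half-spaces. -/
theorem measureReal_pi_increment (h : HasGaussianMarginalsOn μ S Y α) {a b : E} (ha : ‖a‖ = 1)
    (hb : ‖b‖ = 1) {s : ℝ} (hs : 0 < s) (hs1 : s ≤ 1) (hab : ‖b - a‖ ≤ s ^ 2) (t : ℝ) {l : ℝ}
    (hl : 0 < l) (hl1 : l ≤ 1) (n : ℕ) (x : ℝ) :
    (Measure.pi fun _ : Fin n => μ).real
      {ω | n * (0 + 2 * s * l) + x / l ≤
        ∑ i, ((S ∩ {ω | t < ⟪b, Y ω⟫}).indicator (1 : Ω → ℝ) (ω i) -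
          (S ∩ {ω | t < ⟪a, Y ω⟫}).indicator (1 : Ω → ℝ) (ω i))} ≤ Real.exp (-x) := by
  have hma := h.measurableSet_inter_lt a t
  have hmb := h.measurableSet_inter_lt b t
  have hia : Integrable ((S ∩ {ω | t < ⟪a, Y ω⟫}).indicator (1 : Ω → ℝ)) μ :=
    (integrable_const (1 : ℝ)).indicator hma
  have hib : Integrable ((S ∩ {ω | t < ⟪b, Y ω⟫}).indicator (1 : Ω → ℝ)) μ :=
    (integrable_const (1 : ℝ)).indicator hmb
  refine measureReal_pi_bernstein μ
    (D := fun ω => (S ∩ {ω | t < ⟪b, Y ω⟫}).indicator (1 : Ω → ℝ) ω -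
      (S ∩ {ω | t < ⟪a, Y ω⟫}).indicator (1 : Ω → ℝ) ω)
    ((measurable_one.indicator hmb).sub (measurable_one.indicator hma)) (fun ω => ?_) ?_ ?_
    hl hl1 n x
  · by_cases h1 : ω ∈ S ∩ {ω | t < ⟪b, Y ω⟫} <;> by_cases h2 : ω ∈ S ∩ {ω | t < ⟪a, Y ω⟫} <;>
      simp [h1, h2, -Set.mem_inter_iff]
  -- The two half-spaces have equal mass, so the increment is centred; this is the `0` in the
  -- statement.
  · rw [integral_sub hib hia, integral_indicator_one hma, integral_indicator_one hmb,
      h.measureReal_inter_lt ha, h.measureReal_inter_lt hb, sub_self]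
  -- The half-spaces can differ only where `⟪a, Y⟫` is within `s` of the threshold, of mass at most
  -- s, or where `⟪b - a, Y⟫` exceeds `s` in absolute value, of mass at most s² by Chebyshev.
  · set T₁ := S ∩ {ω | |⟪a, Y ω⟫ - t| ≤ s} with hT₁
    set T₂ := S ∩ {ω | s < |⟪b - a, Y ω⟫|} with hT₂
    have hmT : MeasurableSet (T₁ ∪ T₂) :=
      (h.measurableSet.inter (measurableSet_le
        ((h.measurable_inner a).sub_const t).abs measurable_const)).union
      (h.measurableSet.inter (measurableSet_lt measurable_const
        (h.measurable_inner (b - a)).abs))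
    calc ∫ ω, ((S ∩ {ω | t < ⟪b, Y ω⟫}).indicator (1 : Ω → ℝ) ω -
          (S ∩ {ω | t < ⟪a, Y ω⟫}).indicator (1 : Ω → ℝ) ω) ^ 2 ∂μ
        ≤ ∫ ω, (T₁ ∪ T₂).indicator (1 : Ω → ℝ) ω ∂μ := by
          refine integral_mono_of_nonneg (Filter.Eventually.of_forall fun ω => sq_nonneg _)
            ((integrable_const (1 : ℝ)).indicator hmT)
            (Filter.Eventually.of_forall fun ω => ?_)
          by_cases hω : ω ∈ T₁ ∪ T₂
          · rw [Set.indicator_of_mem hω]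
            by_cases h1 : ω ∈ S ∩ {ω | t < ⟪b, Y ω⟫} <;>
              by_cases h2 : ω ∈ S ∩ {ω | t < ⟪a, Y ω⟫} <;>
              simp [h1, h2, -Set.mem_inter_iff]
          · have hiff : ω ∈ S ∩ {ω | t < ⟪b, Y ω⟫} ↔ ω ∈ S ∩ {ω | t < ⟪a, Y ω⟫} := by
              simp only [hT₁, hT₂, Set.mem_union, Set.mem_inter_iff, Set.mem_ofPred_eq, not_or,
                not_and, not_le, not_lt, inner_sub_left] at hω ⊢
              refine and_congr_right fun hS => ?_
              have h1 := hω.1 hS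
              have h2 := abs_le.1 (hω.2 hS)
              rcases lt_abs.1 h1 with h1 | h1 <;> constructor <;> intro h3 <;> linarith
            rw [Set.indicator_of_notMem hω]
            by_cases h2 : ω ∈ S ∩ {ω | t < ⟪a, Y ω⟫} <;>
              simp [hiff, h2, -Set.mem_inter_iff]
      _ = μ.real (T₁ ∪ T₂) := integral_indicator_one hmT
      _ ≤ μ.real T₁ + μ.real T₂ := measureReal_union_le _ _
      _ ≤ s + ‖b - a‖ ^ 2 / s ^ 2 :=
          add_le_add (h.measureReal_inter_abs_sub_le ha hs.le t)
            (h.measureReal_inter_lt_abs_le (b - a) hs)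
      _ ≤ s + (s ^ 2) ^ 2 / s ^ 2 := by gcongr
      _ = s + s * s := by field_simp
      _ ≤ 2 * s := by nlinarith

theorem measureReal_pi_sum_inner_sq (h : HasGaussianMarginalsOn μ S Y α) {a : E} (ha : ‖a‖ = 1)
    (n : ℕ) (x : ℝ) :
    (Measure.pi fun _ : Fin n => μ).real
      {ω | n + x ≤ ∑ i, ⟪a, S.indicator Y (ω i)⟫ ^ 2 / 4} ≤ Real.exp (-x) := by
  obtain ⟨hi, hle⟩ := h.integrable_exp_inner_sq ha
  have := measureReal_pi_le_sum_le μ hi (a := 1)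
    (hle.trans (by linarith [Real.add_one_le_exp (1 : ℝ)])) n (n + x)
  rwa [show (n : ℝ) * 1 - (n + x) = -x by ring] at this

end HasGaussianMarginalsOn

end Marginals

/-! ### Chaining over half-spaces. -/

section UniformDeviation

theorem three_div_pow_le_exp (k : ℕ) : (3 : ℝ) / (1 / 16) ^ k ≤ Real.exp (2 + 3 * k) := by
  have h1 : (3 : ℝ) ≤ Real.exp 2 := by linarith [Real.add_one_le_exp (2 : ℝ)]
  have h2 : (16 : ℝ) ≤ Real.exp 3 := by
    have h := Real.exp_one_gt_d9
    have : Real.exp 3 = Real.exp 1 ^ 3 := by rw [← Real.exp_nat_mul]; norm_num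
    rw [this]
    calc (16 : ℝ) ≤ 2.7 ^ 3 := by norm_num
      _ ≤ Real.exp 1 ^ 3 := pow_le_pow_left₀ (by norm_num) (by linarith) 3
  calc (3 : ℝ) / (1 / 16) ^ k = 3 * 16 ^ k := by
        rw [one_div, inv_pow, div_inv_eq_mul]
    _ ≤ Real.exp 2 * Real.exp 3 ^ k := by gcongr
    _ = Real.exp (2 + 3 * k) := by rw [← Real.exp_nat_mul, ← Real.exp_add, mul_comm (3 : ℝ)]

/-- Nets of the sphere at the scales `16 ^ (-k)`. -/
theorem exists_sphere_nets (E : Type*) [NormedAddCommGroup E] [NormedSpace ℝ E]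
    [FiniteDimensional ℝ E] {N : ℝ} (hN : (Module.finrank ℝ E : ℝ) ≤ N) :
    ∃ s : ℕ → Finset E, ∀ k, (∀ a ∈ s k, ‖a‖ = 1) ∧
      (∀ u : E, ‖u‖ = 1 → ∃ a ∈ s k, ‖u - a‖ ≤ (1 / 16) ^ k) ∧
      ((s k).card : ℝ) ≤ Real.exp (N * (2 + 3 * k)) := by
  have key : ∀ k : ℕ, ∃ s : Finset E, (∀ a ∈ s, ‖a‖ = 1) ∧
      (∀ u : E, ‖u‖ = 1 → ∃ a ∈ s, ‖u - a‖ ≤ (1 / 16) ^ k) ∧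
      (s.card : ℝ) ≤ Real.exp (N * (2 + 3 * k)) := fun k => by
    obtain ⟨s, h1, h2, h3⟩ := exists_sphere_net (E := E) (ρ := (1 / 16) ^ k) (by positivity)
      (pow_le_one₀ (by norm_num) (by norm_num))
    refine ⟨s, h1, h2, h3.trans ?_⟩
    calc (3 / (1 / 16 : ℝ) ^ k) ^ Module.finrank ℝ E
        ≤ Real.exp (2 + 3 * k) ^ Module.finrank ℝ E :=
          pow_le_pow_left₀ (by positivity) (three_div_pow_le_exp k) _
      _ = Real.exp (Module.finrank ℝ E * (2 + 3 * k)) := by rw [← Real.exp_nat_mul]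
      _ ≤ Real.exp (N * (2 + 3 * k)) := by
          apply Real.exp_le_exp.2
          gcongr
  choose s hs using key
  exact ⟨s, hs⟩

theorem add_mul_half_pow_le_seven (K : ℕ) : (7 + 3 * (K : ℝ)) * (1 / 2) ^ K ≤ 7 := by
  have h : (1 : ℝ) + K ≤ 2 ^ K := by
    have := one_add_mul_le_pow (a := (1 : ℝ)) (by norm_num) K
    norm_num at this
    linarith
  rw [one_div, inv_pow, ← div_eq_mul_inv, div_le_iff₀ (by positivity)]
  have : (0 : ℝ) ≤ K := K.cast_nonneg
  linarith

variable {E : Type*} [NormedAddCommGroup E] [InnerProductSpace ℝ E] [FiniteDimensional ℝ E]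
  {Ω : Type*} [MeasurableSpace Ω] {μ : Measure Ω} [IsProbabilityMeasure μ] {S : Set Ω}
  {Y : Ω → E} {α : ℝ}

/-- Uniform upper bound, by chaining, for the empirical masses of the half-spaces
`{t < ⟪u, Y⟫}`. -/
theorem HasGaussianMarginalsOn.measureReal_pi_uniform (h : HasGaussianMarginalsOn μ S Y α)
    {δ : ℝ} (hδ : 0 < δ) (hδ1 : δ ≤ 1 / 10) (n : ℕ)
    (hd : (Module.finrank ℝ E : ℝ) ≤ n * δ ^ 2) (hN : 1 ≤ n * δ ^ 2) (t : ℝ) :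
    (Measure.pi fun _ : Fin n => μ).real
      {ω | ∃ u : E, ‖u‖ = 1 ∧ n * (α * (gaussianReal 0 1).real (Set.Ioi t) + 60 * δ) <
        ∑ i, (S ∩ {ω | t < ⟪u, Y ω⟫}).indicator (1 : Ω → ℝ) (ω i)} ≤
      5 * Real.exp (-(5 * (n * δ ^ 2))) := by
  classical
  set P := Measure.pi fun _ : Fin n => μ with hP
  set N : ℝ := n * δ ^ 2 with hNdef
  set m : ℝ := α * (gaussianReal 0 1).real (Set.Ioi t) with hm
  set f : E → Ω → ℝ := fun u => (S ∩ {ω | t < ⟪u, Y ω⟫}).indicator (1 : Ω → ℝ) with hf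
  obtain ⟨s, hs⟩ := exists_sphere_nets E hd
  -- Chaining stops when 2^(-K) is comparable to δ: `hK'` keeps the Bernstein parameter 2^k δ at
  -- most 1, and `hK` makes the final net finer than 16 δ⁴.
  obtain ⟨K, hK, hK'⟩ := exists_nat_pow_near_of_lt_one hδ (show δ ≤ 1 by linarith)
    (show (0 : ℝ) < 1 / 2 by norm_num) (by norm_num)
  have hn : (0 : ℝ) ≤ n := n.cast_nonneg
  have hm0 : ∀ u : E, ‖u‖ = 1 → μ.real (S ∩ {ω | t < ⟪u, Y ω⟫}) = m := fun u hu =>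
    h.measureReal_inter_lt hu t
  -- Four kinds of bad event: the coarsest net, the links between consecutive nets, the mass near
  -- the threshold for the finest net, and the operator norm of the clean points. Each level x
  -- exceeds the logarithm of the net size by at least 5N.
  set B₀ : Set (Fin n → Ω) := ⋃ a ∈ s 0, {ω | n * (μ.real (S ∩ {ω | t < ⟪a, Y ω⟫}) + 1 * δ) +
    7 * N / δ ≤ ∑ i, f a (ω i)} with hB₀
  set pairs : ℕ → Finset (E × E) := fun k =>
    (s k ×ˢ s (k + 1)).filter fun ab => ‖ab.2 - ab.1‖ ≤ (1 / 16) ^ k with hpairs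
  set B₁ : ℕ → Set (Fin n → Ω) := fun k => ⋃ ab ∈ pairs k,
    {ω | n * (0 + 2 * (1 / 4) ^ k * (2 ^ k * δ)) + (12 + 7 * k) * N / (2 ^ k * δ) ≤
      ∑ i, (f ab.2 (ω i) - f ab.1 (ω i))} with hB₁
  set T : E → Set Ω := fun a => S ∩ {ω | |⟪a, Y ω⟫ - t| ≤ δ} with hT
  set B₂ : Set (Fin n → Ω) := ⋃ a ∈ s K, {ω | n * (μ.real (T a) + δ * 1) +
    (7 + 3 * K) * N / 1 ≤ ∑ i, (T a).indicator (1 : Ω → ℝ) (ω i)} with hB₂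
  set B₃ : Set (Fin n → Ω) := ⋃ a ∈ s 1, {ω | n + 10 * N ≤
    ∑ i, ⟪a, S.indicator Y (ω i)⟫ ^ 2 / 4} with hB₃
  have hP₀ : P.real B₀ ≤ Real.exp (-(5 * N)) := by
    refine (measureReal_biUnion_le_exp P (s 0) _ (x := 7 * N) (fun a ha =>
      measureReal_pi_indicator_bernstein _ (h.measurableSet_inter_lt a t)
        measureReal_le_one hδ (by linarith) n (7 * N)) (hs 0).2.2).trans_eq ?_
    congr 1
    push_cast
    ring
  have hP₁ : ∀ k < K, P.real (B₁ k) ≤ Real.exp (-(5 * N)) * (1 / 2) ^ k := by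
    intro k hk
    have hcard : ((pairs k).card : ℝ) ≤ Real.exp (N * (7 + 6 * k)) := by
      calc ((pairs k).card : ℝ) ≤ ((s k ×ˢ s (k + 1)).card : ℝ) := by
            exact_mod_cast Finset.card_filter_le _ _
        _ = (s k).card * (s (k + 1)).card := by rw [Finset.card_product]; push_cast; rfl
        _ ≤ Real.exp (N * (2 + 3 * k)) * Real.exp (N * (2 + 3 * (k + 1 : ℕ))) :=
            mul_le_mul (hs k).2.2 (hs (k + 1)).2.2 (Nat.cast_nonneg _) (Real.exp_pos _).le
        _ = Real.exp (N * (7 + 6 * k)) := by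
            rw [← Real.exp_add]
            congr 1
            push_cast
            ring
    have hlk : (2 : ℝ) ^ k * δ ≤ 1 := by
      calc (2 : ℝ) ^ k * δ ≤ 2 ^ K * (1 / 2) ^ K := by
            gcongr
            norm_num
        _ = 1 := by rw [← mul_pow]; norm_num
    refine (measureReal_biUnion_le_exp P (pairs k) _ (x := (12 + 7 * k) * N) (fun ab hab => ?_)
      hcard).trans ?_
    · simp only [hpairs, Finset.mem_filter, Finset.mem_product] at hab
      refine h.measureReal_pi_increment ((hs k).1 _ hab.1.1) ((hs (k + 1)).1 _ hab.1.2)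
        (s := (1 / 4) ^ k) (by positivity) (pow_le_one₀ (by norm_num) (by norm_num)) ?_ t
        (by positivity) hlk n _
      rw [← pow_mul, mul_comm k 2, pow_mul]
      norm_num at hab ⊢
      exact hab.2
    -- The surplus k N in the exponent makes the probabilities summable over k, since N ≥ 1 gives
    -- exp(-N) ≤ 1/2.
    · have e : N * (7 + 6 * k) - (12 + 7 * k) * N = -(5 * N) + k * (-N) := by ring
      rw [e, Real.exp_add, Real.exp_nat_mul]
      gcongr
      rw [Real.exp_neg, one_div]
      gcongr
      linarith [Real.add_one_le_exp N]
  have hP₂ : P.real B₂ ≤ Real.exp (-(5 * N)) := by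
    refine (measureReal_biUnion_le_exp P (s K) _ (x := (7 + 3 * K) * N) (fun a ha =>
      measureReal_pi_indicator_bernstein _ (h.measurableSet.inter (measurableSet_le
        ((h.measurable_inner a).sub_const t).abs measurable_const))
        (h.measureReal_inter_abs_sub_le ((hs K).1 a ha) hδ.le t) one_pos le_rfl n _)
        (hs K).2.2).trans_eq ?_
    congr 1
    ring
  have hP₃ : P.real B₃ ≤ Real.exp (-(5 * N)) := by
    refine (measureReal_biUnion_le_exp P (s 1) _ (x := 10 * N) (fun a ha =>
      h.measureReal_pi_sum_inner_sq ((hs 1).1 a ha) n _) (hs 1).2.2).trans_eq ?_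
    congr 1
    push_cast
    ring
  have hsub : {ω | ∃ u : E, ‖u‖ = 1 ∧ n * (m + 60 * δ) < ∑ i, f u (ω i)} ⊆
      ((B₀ ∪ ⋃ k ∈ Finset.range K, B₁ k) ∪ B₂) ∪ B₃ := by
    intro ω hω
    by_contra hgood
    obtain ⟨u, hu, hlt⟩ := hω
    simp only [Set.mem_union, not_or] at hgood
    obtain ⟨⟨⟨g₀, g₁⟩, g₂⟩, g₃⟩ := hgood
    simp only [hB₀, Set.mem_iUnion, Set.mem_ofPred_eq, not_exists, not_le] at g₀
    simp only [hB₁, hpairs, Set.mem_iUnion, Set.mem_ofPred_eq, not_exists, not_le,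
      Finset.mem_range, Finset.mem_filter, Finset.mem_product, and_imp, Prod.forall] at g₁
    simp only [hB₂, Set.mem_iUnion, Set.mem_ofPred_eq, not_exists, not_le] at g₂
    simp only [hB₃, Set.mem_iUnion, Set.mem_ofPred_eq, not_exists, not_le] at g₃
    -- The base level costs 8δ and link k costs (14 + 7k) 2^(-k) δ. The bracket is the closed form
    -- of the partial sums of (14 + 7j) 2^(-j), whose total is 42.
    have hchain : ∀ k ≤ K, ∀ a ∈ s k,
        ∑ i, f a (ω i) ≤ n * (m + 8 * δ + δ * (42 - (42 + 14 * k) * (1 / 2) ^ k)) := by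
      intro k
      induction k with
      | zero =>
        intro _ a ha
        have := g₀ a ha
        rw [hm0 a ((hs 0).1 a ha)] at this
        refine this.le.trans_eq ?_
        rw [hNdef]
        field_simp
        push_cast
        ring
      | succ k ih =>
        intro hk b hb
        obtain ⟨a, ha, hab⟩ := (hs k).2.1 b ((hs (k + 1)).1 b hb)
        have h1 := ih (by omega) a ha
        have h2 := g₁ k (by omega) a b ha hb hab
        rw [Finset.sum_sub_distrib] at h2
        have e : n * (0 + 2 * (1 / 4 : ℝ) ^ k * (2 ^ k * δ)) + (12 + 7 * k) * N / (2 ^ k * δ) =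
            n * (δ * ((14 + 7 * k) * (1 / 2) ^ k)) := by
          have e1 : (1 / 4 : ℝ) ^ k * 2 ^ k = (1 / 2) ^ k := by rw [← mul_pow]; norm_num
          have e2 : N / (2 ^ k * δ) = n * δ * (1 / 2) ^ k := by
            rw [hNdef, one_div, inv_pow]
            field_simp
          rw [mul_div_assoc, e2]
          linear_combination (2 * n * δ) * e1
        rw [e] at h2
        have e3 : (n : ℝ) * (m + 8 * δ + δ * (42 - (42 + 14 * k) * (1 / 2) ^ k)) +
            n * (δ * ((14 + 7 * k) * (1 / 2) ^ k)) =
            n * (m + 8 * δ + δ * (42 - (42 + 14 * (k + 1 : ℕ)) * (1 / 2) ^ (k + 1))) := by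
          push_cast
          ring
        linarith
    obtain ⟨a, ha, hua⟩ := (hs K).2.1 u hu
    have h1 : ∑ i, f a (ω i) ≤ n * (m + 50 * δ) := by
      refine (hchain K le_rfl a ha).trans (mul_le_mul_of_nonneg_left ?_ hn)
      have : 0 ≤ δ * ((42 + 14 * K) * (1 / 2) ^ K) := by positivity
      nlinarith
    have h2 : ∑ i, (T a).indicator (1 : Ω → ℝ) (ω i) ≤ n * (9 * δ) := by
      refine (g₂ a ha).le.trans ?_
      have hTa : μ.real (T a) ≤ δ := h.measureReal_inter_abs_sub_le ((hs K).1 a ha) hδ.le t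
      have e : (7 + 3 * (K : ℝ)) * N ≤ n * (7 * δ) := by
        calc (7 + 3 * (K : ℝ)) * N = n * δ * ((7 + 3 * K) * δ) := by rw [hNdef]; ring
          _ ≤ n * δ * ((7 + 3 * K) * (1 / 2) ^ K) := by gcongr
          _ ≤ n * δ * 7 := by
              gcongr
              exact add_mul_half_pow_le_seven K
          _ = n * (7 * δ) := by ring
      have e2 : (n : ℝ) * (μ.real (T a) + δ * 1) ≤ n * (δ + δ * 1) := by gcongr
      rw [div_one]
      linarith
    have hop : ∀ w : E, ∑ i, ⟪w, S.indicator Y (ω i)⟫ ^ 2 ≤ 4 * (5 * n) * ‖w‖ ^ 2 := by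
      refine sum_inner_sq_le_of_net (fun i => S.indicator Y (ω i)) (s 1 : Set E)
        (fun u hu => ?_) (fun a ha => ?_)
      · obtain ⟨a, ha, hua⟩ := (hs 1).2.1 u hu
        exact ⟨a, ha, hua.trans (by norm_num)⟩
      · have := g₃ a ha
        rw [← Finset.sum_div] at this
        have hNn : 10 * N ≤ n / 10 := by
          rw [hNdef]
          have : δ ^ 2 ≤ (1 / 10) ^ 2 := pow_le_pow_left₀ hδ.le hδ1 2
          nlinarith
        linarith
    have h3 : ∑ i, ⟪u - a, S.indicator Y (ω i)⟫ ^ 2 / δ ^ 2 ≤ n * δ := by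
      rw [← Finset.sum_div, div_le_iff₀ (by positivity)]
      have hρ : ‖u - a‖ ≤ 16 * δ ^ 4 := by
        have h2δ : (1 / 2 : ℝ) ^ K ≤ 2 * δ := by
          rw [pow_succ] at hK
          linarith
        calc ‖u - a‖ ≤ (1 / 16) ^ K := hua
          _ = ((1 / 2) ^ K) ^ 4 := by rw [← pow_mul, mul_comm, pow_mul]; norm_num
          _ ≤ (2 * δ) ^ 4 := pow_le_pow_left₀ (by positivity) h2δ 4
          _ = 16 * δ ^ 4 := by ring
      have hδ5 : δ ^ 5 ≤ (1 / 10) ^ 5 := pow_le_pow_left₀ hδ.le hδ1 5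
      calc ∑ i, ⟪u - a, S.indicator Y (ω i)⟫ ^ 2 ≤ 4 * (5 * n) * ‖u - a‖ ^ 2 := hop _
        _ ≤ 4 * (5 * n) * (16 * δ ^ 4) ^ 2 := by gcongr
        _ = n * (δ ^ 3 * (5120 * δ ^ 5)) := by ring
        _ ≤ n * (δ ^ 3 * 1) := by
            gcongr
            linarith
        _ = n * δ * δ ^ 2 := by ring
    -- A point in the half-space of `u` but not in that of `a` is either within δ of the threshold
    -- along `a` or satisfies ⟪u - a, Y⟫ ≥ δ. The three terms sum to at most n(m + 50δ), 9nδ and nδ,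
    -- giving 60δ.
    have hpt : ∀ i, f u (ω i) ≤ f a (ω i) + (T a).indicator (1 : Ω → ℝ) (ω i) +
        ⟪u - a, S.indicator Y (ω i)⟫ ^ 2 / δ ^ 2 := by
      intro i
      have p1 : 0 ≤ f a (ω i) := Set.indicator_nonneg (fun _ _ => zero_le_one) _
      have p2 : 0 ≤ (T a).indicator (1 : Ω → ℝ) (ω i) :=
        Set.indicator_nonneg (fun _ _ => zero_le_one) _
      have p3 : 0 ≤ ⟪u - a, S.indicator Y (ω i)⟫ ^ 2 / δ ^ 2 := by positivity
      by_cases hiu : ω i ∈ S ∩ {ω | t < ⟪u, Y ω⟫}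
      · have e0 : f u (ω i) = 1 := Set.indicator_of_mem hiu _
        by_cases hia : ω i ∈ S ∩ {ω | t < ⟪a, Y ω⟫}
        · have e1 : f a (ω i) = 1 := Set.indicator_of_mem hia _
          linarith
        by_cases hiT : ω i ∈ T a
        · have e1 : (T a).indicator (1 : Ω → ℝ) (ω i) = 1 := Set.indicator_of_mem hiT _
          linarith
        have hS := hiu.1
        have q1 : t < ⟪u, Y (ω i)⟫ := hiu.2
        have q2 : ⟪a, Y (ω i)⟫ ≤ t := not_lt.1 fun hlt => hia ⟨hS, hlt⟩
        have q3 : δ < |⟪a, Y (ω i)⟫ - t| := not_le.1 fun hle => hiT ⟨hS, hle⟩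
        rw [abs_of_nonpos (by linarith)] at q3
        have q4 : δ ≤ ⟪u - a, S.indicator Y (ω i)⟫ := by
          rw [Set.indicator_of_mem hS, inner_sub_left]
          linarith
        have q5 : 1 ≤ ⟪u - a, S.indicator Y (ω i)⟫ ^ 2 / δ ^ 2 := by
          rw [one_le_div (by positivity)]
          exact pow_le_pow_left₀ hδ.le q4 2
        linarith
      · have e0 : f u (ω i) = 0 := Set.indicator_of_notMem hiu _
        linarith
    have hsum := Finset.sum_le_sum fun i (_ : i ∈ Finset.univ) => hpt i
    rw [Finset.sum_add_distrib, Finset.sum_add_distrib] at hsum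
    linarith
  have hgeom : P.real (⋃ k ∈ Finset.range K, B₁ k) ≤ 2 * Real.exp (-(5 * N)) := by
    calc P.real (⋃ k ∈ Finset.range K, B₁ k) ≤ ∑ k ∈ Finset.range K, P.real (B₁ k) :=
          measureReal_biUnion_finset_le _ _
      _ ≤ ∑ k ∈ Finset.range K, Real.exp (-(5 * N)) * (1 / 2) ^ k :=
          Finset.sum_le_sum fun k hk => hP₁ k (Finset.mem_range.1 hk)
      _ ≤ Real.exp (-(5 * N)) * 2 := by
          rw [← Finset.mul_sum]
          gcongr
          exact sum_geometric_two_le K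
      _ = 2 * Real.exp (-(5 * N)) := mul_comm _ _
  calc P.real {ω | ∃ u : E, ‖u‖ = 1 ∧ n * (m + 60 * δ) < ∑ i, f u (ω i)}
      ≤ P.real (((B₀ ∪ ⋃ k ∈ Finset.range K, B₁ k) ∪ B₂) ∪ B₃) := measureReal_mono hsub
    _ ≤ P.real B₀ + P.real (⋃ k ∈ Finset.range K, B₁ k) + P.real B₂ + P.real B₃ := by
        have i1 := measureReal_union_le (μ := P) ((B₀ ∪ ⋃ k ∈ Finset.range K, B₁ k) ∪ B₂) B₃
        have i2 := measureReal_union_le (μ := P) (B₀ ∪ ⋃ k ∈ Finset.range K, B₁ k) B₂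
        have i3 := measureReal_union_le (μ := P) B₀ (⋃ k ∈ Finset.range K, B₁ k)
        linarith
    _ ≤ 5 * Real.exp (-(5 * N)) := by linarith

end UniformDeviation

/-! ### Labelling the clean and the contaminated points. -/

section Coupling

variable {p : ℕ}

theorem multivariateGaussian_one_map_inner_sub (θ u : EuclideanSpace ℝ (Fin p)) :
    (multivariateGaussian θ (1 : Matrix (Fin p) (Fin p) ℝ)).map (fun x => ⟪u, x - θ⟫) =
      gaussianReal 0 (‖u‖₊ ^ 2) := by
  have h1 : multivariateGaussian θ (1 : Matrix (Fin p) (Fin p) ℝ) =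
      (stdGaussian (EuclideanSpace ℝ (Fin p))).map (fun x => θ + x) := by
    simp [multivariateGaussian]
  have h2 : (fun x => ⟪u, x - θ⟫) ∘ (fun x => θ + x) =
      ⇑(innerSL ℝ u : StrongDual ℝ (EuclideanSpace ℝ (Fin p))) := by
    ext x
    simp
  rw [h1, Measure.map_map (by fun_prop) (by fun_prop), h2, IsGaussian.map_eq_gaussianReal,
    integral_strongDual_stdGaussian, variance_dual_stdGaussian, innerSL_apply_norm]
  congr 1
  ext
  simp

/-- The contaminated Gaussian distribution, with a label that tells clean points (`true`) from
contaminated ones (`false`). -/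
noncomputable def labelledContaminatedGaussian (ε : ℝ) (θ : EuclideanSpace ℝ (Fin p))
    (Q : Measure (EuclideanSpace ℝ (Fin p))) : Measure (EuclideanSpace ℝ (Fin p) × Bool) :=
  ENNReal.ofReal (1 - ε) •
      (multivariateGaussian θ (1 : Matrix (Fin p) (Fin p) ℝ)).map (fun x => (x, true)) +
    ENNReal.ofReal ε • Q.map (fun x => (x, false))

theorem labelledContaminatedGaussian_map_fst (ε : ℝ) (θ : EuclideanSpace ℝ (Fin p))
    (Q : Measure (EuclideanSpace ℝ (Fin p))) :
    (labelledContaminatedGaussian ε θ Q).map Prod.fst = contaminatedGaussian ε θ Q := by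
  have h : ∀ b : Bool, (Prod.fst ∘ fun x : EuclideanSpace ℝ (Fin p) => (x, b)) = id := fun b => rfl
  rw [labelledContaminatedGaussian, Measure.map_add _ _ measurable_fst, Measure.map_smul,
    Measure.map_smul, Measure.map_map measurable_fst (by fun_prop),
    Measure.map_map measurable_fst (by fun_prop), h, h, Measure.map_id, Measure.map_id,
    contaminatedGaussian]

theorem isProbabilityMeasure_labelledContaminatedGaussian {ε : ℝ} (hε0 : 0 ≤ ε) (hε1 : ε ≤ 1)
    (θ : EuclideanSpace ℝ (Fin p)) (Q : Measure (EuclideanSpace ℝ (Fin p)))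
    [IsProbabilityMeasure Q] : IsProbabilityMeasure (labelledContaminatedGaussian ε θ Q) := by
  have := isProbabilityMeasure_contaminatedGaussian hε0 hε1 θ Q
  rw [← labelledContaminatedGaussian_map_fst] at this
  exact Measure.isProbabilityMeasure_of_map Prod.fst

theorem labelledContaminatedGaussian_restrict (ε : ℝ) (θ : EuclideanSpace ℝ (Fin p))
    (Q : Measure (EuclideanSpace ℝ (Fin p))) :
    (labelledContaminatedGaussian ε θ Q).restrict (Prod.snd ⁻¹' {true}) =
      ENNReal.ofReal (1 - ε) •
        (multivariateGaussian θ (1 : Matrix (Fin p) (Fin p) ℝ)).map (fun x => (x, true)) := by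
  have hS : MeasurableSet (Prod.snd ⁻¹' {true} : Set (EuclideanSpace ℝ (Fin p) × Bool)) :=
    measurable_snd (measurableSet_singleton _)
  rw [labelledContaminatedGaussian, Measure.restrict_add, Measure.restrict_smul,
    Measure.restrict_smul, Measure.restrict_map (by fun_prop) hS,
    Measure.restrict_map (by fun_prop) hS]
  have h1 : (fun x : EuclideanSpace ℝ (Fin p) => (x, true)) ⁻¹' (Prod.snd ⁻¹' {true}) =
      Set.univ := by ext; simp
  have h2 : (fun x : EuclideanSpace ℝ (Fin p) => (x, false)) ⁻¹' (Prod.snd ⁻¹' {true}) = ∅ := by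
    ext; simp
  rw [h1, h2]
  simp

theorem hasGaussianMarginalsOn_labelledContaminatedGaussian {ε : ℝ} (hε0 : 0 ≤ ε) (hε1 : ε ≤ 1)
    (θ : EuclideanSpace ℝ (Fin p)) (Q : Measure (EuclideanSpace ℝ (Fin p))) :
    HasGaussianMarginalsOn (labelledContaminatedGaussian ε θ Q) (Prod.snd ⁻¹' {true})
      (fun ω => ω.1 - θ) (1 - ε) where
  nonneg := by linarith
  le_one := by linarith
  measurableSet := measurable_snd (measurableSet_singleton _)
  measurable_inner u := by fun_prop
  map_inner u := by
    rw [labelledContaminatedGaussian_restrict, Measure.map_smul,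
      Measure.map_map (by fun_prop) (by fun_prop), ← multivariateGaussian_one_map_inner_sub θ u]
    rfl

end Coupling

/-! ### From half-space counts to Tukey's depth. -/

section Sample

variable {p n : ℕ}

/-- The samples all of whose half-spaces `{t < ⟪u, x - θ⟫}` carry at most `b` points. -/
def halfspaceCountLE (n : ℕ) (θ : EuclideanSpace ℝ (Fin p)) (t b : ℝ) :
    Set (Fin n → EuclideanSpace ℝ (Fin p)) :=
  {X | ∀ u : EuclideanSpace ℝ (Fin p), ‖u‖ = 1 →
    ∑ i, {x | t < ⟪u, x - θ⟫}.indicator (1 : EuclideanSpace ℝ (Fin p) → ℝ) (X i) ≤ b}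

/-- Indicators of open half-spaces are lower semicontinuous, so each constraint is closed.
Closedness survives the intersection over uncountably many directions and yields measurability. -/
theorem isClosed_halfspaceCountLE (θ : EuclideanSpace ℝ (Fin p)) (t b : ℝ) :
    IsClosed (halfspaceCountLE n θ t b) := by
  have hset : halfspaceCountLE n θ t b = ⋂ u : EuclideanSpace ℝ (Fin p), ⋂ _ : ‖u‖ = 1,
      (fun X : Fin n → EuclideanSpace ℝ (Fin p) => ∑ i,
        {x | t < ⟪u, x - θ⟫}.indicator (fun _ => (1 : ℝ)) (X i)) ⁻¹' Set.Iic b := by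
    ext X
    simp only [halfspaceCountLE, Set.mem_ofPred_eq, Set.mem_iInter, Set.mem_preimage, Set.mem_Iic]
    rfl
  rw [hset]
  refine isClosed_iInter fun u => isClosed_iInter fun _ => ?_
  refine LowerSemicontinuous.isClosed_preimage (lowerSemicontinuous_sum fun i _ => ?_) b
  have hopen : IsOpen {x : EuclideanSpace ℝ (Fin p) | t < ⟪u, x - θ⟫} :=
    isOpen_lt continuous_const (by fun_prop)
  exact (hopen.lowerSemicontinuous_indicator zero_le_one).comp (continuous_apply i)

theorem tukeyDepth_le_of_mem_sphere (η u : EuclideanSpace ℝ (Fin p)) (hu : ‖u‖ = 1)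
    (P : Measure (EuclideanSpace ℝ (Fin p))) :
    tukeyDepth η P ≤ P.real {x | ⟪u, x⟫ ≤ ⟪u, η⟫} :=
  ciInf_le (f := fun u : Metric.sphere (0 : EuclideanSpace ℝ (Fin p)) 1 =>
    P.real {x | ⟪(u : EuclideanSpace ℝ (Fin p)), x⟫ ≤ ⟪(u : EuclideanSpace ℝ (Fin p)), η⟫})
    ⟨0, by rintro _ ⟨v, rfl⟩; exact measureReal_nonneg⟩ ⟨u, by simpa using hu⟩

theorem le_tukeyDepth_of_mem_halfspaceCountLE (hp : 1 ≤ p) (hn : 1 ≤ n)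
    {θ : EuclideanSpace ℝ (Fin p)} {a : ℝ} {X : Fin n → EuclideanSpace ℝ (Fin p)}
    (hX : X ∈ halfspaceCountLE n θ 0 (n * a)) :
    1 - a ≤ tukeyDepth θ (empiricalDistribution X) := by
  have hn0 : (0 : ℝ) < n := by exact_mod_cast hn
  have : Nonempty (Fin p) := ⟨⟨0, hp⟩⟩
  -- An infimum over an empty sphere would be 0 by convention, so p ≥ 1 matters here.
  have : Nonempty (Metric.sphere (0 : EuclideanSpace ℝ (Fin p)) 1) :=
    (NormedSpace.sphere_nonempty.2 zero_le_one).to_subtype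
  refine le_ciInf fun u => ?_
  have hu : ‖(u : EuclideanSpace ℝ (Fin p))‖ = 1 := by simp
  rw [empiricalDistribution_real_halfspace]
  have hcount := hX u hu
  have hcompl : ∀ i, {x | ⟪(u : EuclideanSpace ℝ (Fin p)), x⟫ ≤ ⟪(u : EuclideanSpace ℝ (Fin p)),
      θ⟫}.indicator (fun _ => (1 : ℝ)) (X i) = 1 - {x | 0 < ⟪(u : EuclideanSpace ℝ (Fin p)),
        x - θ⟫}.indicator (1 : EuclideanSpace ℝ (Fin p) → ℝ) (X i) := fun i => by
    rcases le_or_gt ⟪(u : EuclideanSpace ℝ (Fin p)), X i⟫ ⟪(u : EuclideanSpace ℝ (Fin p)), θ⟫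
      with hle | hlt
    · simp [inner_sub_right, hle, not_lt.2 hle]
    · simp [inner_sub_right, hlt, not_le.2 hlt]
  rw [Finset.sum_congr rfl fun i _ => hcompl i, Finset.sum_sub_distrib, one_div,
    inv_mul_eq_div, le_div_iff₀ hn0]
  simp only [Finset.sum_const, Finset.card_univ, Fintype.card_fin, nsmul_eq_mul, mul_one]
  linarith

theorem tukeyDepth_le_of_mem_halfspaceCountLE (hn : 1 ≤ n) {θ η : EuclideanSpace ℝ (Fin p)}
    {r a : ℝ} (hr : 0 ≤ r) (hη : r < ‖η - θ‖) {X : Fin n → EuclideanSpace ℝ (Fin p)}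
    (hX : X ∈ halfspaceCountLE n θ r (n * a)) :
    tukeyDepth η (empiricalDistribution X) ≤ a := by
  have hn0 : (0 : ℝ) < n := by exact_mod_cast hn
  have hpos : 0 < ‖η - θ‖ := hr.trans_lt hη
  set v : EuclideanSpace ℝ (Fin p) := ‖η - θ‖⁻¹ • (η - θ) with hv
  have hv1 : ‖v‖ = 1 := norm_smul_inv_norm (norm_pos_iff.1 hpos)
  have hvη : ⟪v, η - θ⟫ = ‖η - θ‖ := by
    rw [hv, real_inner_smul_left, real_inner_self_eq_norm_sq]
    field_simp
  -- The half-space through η facing away from θ consists of points with ⟪v, x - θ⟫ ≥ ‖η - θ‖ > r.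
  refine (tukeyDepth_le_of_mem_sphere η (-v) (by rwa [norm_neg]) _).trans ?_
  rw [empiricalDistribution_real_halfspace, one_div, inv_mul_eq_div, div_le_iff₀ hn0, mul_comm]
  refine (Finset.sum_le_sum fun i _ => ?_).trans (hX v hv1)
  refine Set.indicator_le_indicator_of_subset (fun x hx => ?_) (fun _ => zero_le_one) (X i)
  simp only [Set.mem_ofPred_eq, inner_neg_left, inner_sub_right] at hx hvη ⊢
  linarith

/-- Under contamination, with high probability the empirical masses of the half-spaces
`{t < ⟪u, x - θ⟫}` are uniformly at most the Gaussian mass plus the contamination level, up to the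
parametric rate. -/
theorem contaminatedGaussian_pi_compl_halfspaceCountLE {ε : ℝ} (hε0 : 0 ≤ ε) (hε1 : ε ≤ 1)
    (θ : EuclideanSpace ℝ (Fin p)) (Q : Measure (EuclideanSpace ℝ (Fin p)))
    [IsProbabilityMeasure Q] {δ : ℝ} (hδ : 0 < δ) (hδ1 : δ ≤ 1 / 10) (hd : (p : ℝ) ≤ n * δ ^ 2)
    (hN : 1 ≤ n * δ ^ 2) (t : ℝ) :
    (Measure.pi fun _ : Fin n => contaminatedGaussian ε θ Q).real
      (halfspaceCountLE n θ t
        (n * ((1 - ε) * (gaussianReal 0 1).real (Set.Ioi t) + ε + 66 * δ)))ᶜ ≤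
      6 * Real.exp (-(5 * (n * δ ^ 2))) := by
  have := isProbabilityMeasure_labelledContaminatedGaussian hε0 hε1 θ Q
  set μ := labelledContaminatedGaussian ε θ Q with hμ
  set S : Set (EuclideanSpace ℝ (Fin p) × Bool) := Prod.snd ⁻¹' {true} with hS
  set g := (1 - ε) * (gaussianReal 0 1).real (Set.Ioi t) with hg
  have hM := hasGaussianMarginalsOn_labelledContaminatedGaussian hε0 hε1 θ Q
  rw [← hμ, ← hS] at hM
  have hmap : (Measure.pi fun _ : Fin n => contaminatedGaussian ε θ Q) =
      (Measure.pi fun _ : Fin n => μ).map (fun ω i => (ω i).1) := by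
    have hprob := isProbabilityMeasure_contaminatedGaussian hε0 hε1 θ Q
    rw [Measure.pi_map_pi (μ := fun _ : Fin n => μ) (f := fun _ => Prod.fst)]
    · simp only [hμ, labelledContaminatedGaussian_map_fst]
    · exact fun _ => measurable_fst.aemeasurable
  rw [hmap, map_measureReal_apply (by fun_prop)
    (isClosed_halfspaceCountLE θ t _).measurableSet.compl]
  have hclean := hM.measureReal_pi_uniform hδ hδ1 n (by simpa using hd) hN t
  have hlabel := measureReal_pi_indicator_bernstein (μ := μ) Sᶜ hM.measurableSet.compl
    measureReal_le_one hδ (by linarith) n (5 * (n * δ ^ 2))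
  have hSc : μ.real Sᶜ = ε := by
    rw [probReal_compl_eq_one_sub hM.measurableSet, hM.measureReal_eq]
    ring
  have e : (n : ℝ) * (ε + 1 * δ) + 5 * (n * δ ^ 2) / δ = n * (ε + 6 * δ) := by
    field_simp
    ring
  rw [hSc, e] at hlabel
  have hunion := (measureReal_union_le _ _).trans (add_le_add hclean hlabel)
  refine le_trans ?_ (hunion.trans_eq (by ring))
  -- The uniform event on labelled samples need not be measurable; monotonicity of the outer measure
  -- suffices.
  refine measureReal_mono fun ω hω => ?_
  by_contra hgood
  rw [Set.mem_union, not_or, Set.mem_ofPred_eq, Set.mem_ofPred_eq] at hgood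
  push Not at hgood
  obtain ⟨h1, h2⟩ := hgood
  refine hω fun u hu => ?_
  have h3 := h1 u hu
  calc ∑ i, {x | t < ⟪u, x - θ⟫}.indicator (1 : EuclideanSpace ℝ (Fin p) → ℝ) (ω i).1
      ≤ ∑ i, ((S ∩ {ω | t < ⟪u, ω.1 - θ⟫}).indicator
          (1 : EuclideanSpace ℝ (Fin p) × Bool → ℝ) (ω i) +
          Sᶜ.indicator (1 : EuclideanSpace ℝ (Fin p) × Bool → ℝ) (ω i)) := by
        refine Finset.sum_le_sum fun i _ => ?_
        by_cases hi : ω i ∈ S <;> by_cases hi2 : t < ⟪u, (ω i).1 - θ⟫ <;>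
          simp [hi, hi2]
    _ ≤ n * (g + 60 * δ) + n * (ε + 6 * δ) := by
        rw [Finset.sum_add_distrib]
        exact add_le_add h3 h2.le
    _ = n * (g + ε + 66 * δ) := by ring

end Sample

/-! ### Choice of constants and conclusion. -/

theorem theorem2p1 :
    ∃ c C C' : ℝ, 0 < c ∧ 0 < C ∧ 0 < C' ∧
      ∀ (p n : ℕ), 1 ≤ p → 1 ≤ n → (p : ℝ) / (n : ℝ) < c →
      ∀ ε : ℝ, 0 ≤ ε → ε < 1 / 4 →
      ∀ (θ : EuclideanSpace ℝ (Fin p)) (Q : Measure (EuclideanSpace ℝ (Fin p))),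
        IsProbabilityMeasure Q →
        ∃ A : Set (Fin n → EuclideanSpace ℝ (Fin p)),
          MeasurableSet A ∧
          1 - Real.exp (-(C' * ((p : ℝ) + (n : ℝ) * ε ^ 2))) ≤
            (Measure.pi fun _ : Fin n => contaminatedGaussian ε θ Q).real A ∧
          ∀ X ∈ A, ∀ θhat : EuclideanSpace ℝ (Fin p), IsTukeyMedian X θhat →
            ‖θhat - θ‖ ^ 2 ≤ C * max ((p : ℝ) / (n : ℝ)) (ε ^ 2) := by
  refine ⟨1 / 10 ^ 7, 6 * 10 ^ 6, 1 / 10 ^ 7, by norm_num, by norm_num, by norm_num, ?_⟩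
  intro p n hp hn hpn ε hε0 hε1 θ Q hQ
  have hn0 : (0 : ℝ) < n := by exact_mod_cast hn
  have hp1 : (1 : ℝ) ≤ p := by exact_mod_cast hp
  have hprob := isProbabilityMeasure_contaminatedGaussian hε0 (by linarith : ε ≤ 1) θ Q
  -- The ε² term puts nε² into the exponent of the probability bound; its small coefficient keeps δ
  -- ≤ 1/1584.
  set δ : ℝ := √(p / n + 1 / 10 ^ 7 * ε ^ 2) with hδdef
  have hpn0 : (0 : ℝ) < p / n := by positivity
  have hδsq : δ ^ 2 = p / n + 1 / 10 ^ 7 * ε ^ 2 := Real.sq_sqrt (by positivity)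
  have hδ : 0 < δ := Real.sqrt_pos.2 (by positivity)
  have hδ1 : δ ≤ 1 / 1584 := by
    refine abs_le_of_sq_le_sq' (a := δ) (b := 1 / 1584) ?_ (by norm_num) |>.2
    rw [hδsq]
    nlinarith
  have hN : (n : ℝ) * δ ^ 2 = p + 1 / 10 ^ 7 * (n * ε ^ 2) := by
    rw [hδsq]
    field_simp
  have hnε : 0 ≤ (n : ℝ) * ε ^ 2 := by positivity
  -- Here ε + 132δ ≤ 1/4 + 1/12 = 1/3, so r ≤ 3. The factor 9 gives (4/27) r = (4/3)(ε + 132δ), and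
  -- (1 - ε)(4/3) > 1 when ε < 1/4.
  set r : ℝ := 9 * (ε + 132 * δ) with hr
  have hdev := contaminatedGaussian_pi_compl_halfspaceCountLE (n := n) hε0
    (by linarith : ε ≤ 1) θ Q hδ (by linarith) (by linarith) (by linarith)
  set A₀ := halfspaceCountLE n θ 0
    (n * ((1 - ε) * (gaussianReal 0 1).real (Set.Ioi 0) + ε + 66 * δ)) with hA₀
  set A₁ := halfspaceCountLE n θ r
    (n * ((1 - ε) * (gaussianReal 0 1).real (Set.Ioi r) + ε + 66 * δ)) with hA₁
  have hm : MeasurableSet (A₀ ∩ A₁) :=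
    (isClosed_halfspaceCountLE θ 0 _).measurableSet.inter
      (isClosed_halfspaceCountLE θ r _).measurableSet
  refine ⟨A₀ ∩ A₁, hm, ?_, fun X hX θhat hmed => ?_⟩
  · set P := Measure.pi fun _ : Fin n => contaminatedGaussian ε θ Q
    have hcompl : P.real (A₀ ∩ A₁)ᶜ ≤ 12 * Real.exp (-(5 * (n * δ ^ 2))) := by
      rw [Set.compl_inter]
      exact (measureReal_union_le _ _).trans
        ((add_le_add (hdev 0) (hdev r)).trans_eq (by ring))
    rw [probReal_compl_eq_one_sub hm] at hcompl
    -- Since p ≥ 1, part of the exponent 5nδ² absorbs the factor 12 from the two union bounds.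
    have h4 : 12 * Real.exp (-4) ≤ 1 := by
      have h := Real.exp_one_gt_d9
      have e4 : Real.exp 4 = Real.exp 1 ^ 4 := by rw [← Real.exp_nat_mul]; norm_num
      have : (12 : ℝ) ≤ Real.exp 4 := by
        rw [e4]
        calc (12 : ℝ) ≤ 2.7 ^ 4 := by norm_num
          _ ≤ Real.exp 1 ^ 4 := pow_le_pow_left₀ (by norm_num) (by linarith) 4
      rw [Real.exp_neg, ← div_eq_mul_inv]
      exact (div_le_one (Real.exp_pos _)).2 this
    have hexp : 12 * Real.exp (-(5 * (n * δ ^ 2))) ≤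
        Real.exp (-(1 / 10 ^ 7 * ((p : ℝ) + (n : ℝ) * ε ^ 2))) := by
      calc 12 * Real.exp (-(5 * (n * δ ^ 2)))
          ≤ 12 * Real.exp (-4 + -(1 / 10 ^ 7 * ((p : ℝ) + (n : ℝ) * ε ^ 2))) := by
            gcongr
            rw [hN]
            linarith
        _ = 12 * Real.exp (-4) * Real.exp (-(1 / 10 ^ 7 * ((p : ℝ) + (n : ℝ) * ε ^ 2))) := by
            rw [Real.exp_add, mul_assoc]
        _ ≤ 1 * Real.exp (-(1 / 10 ^ 7 * ((p : ℝ) + (n : ℝ) * ε ^ 2))) :=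
            mul_le_mul_of_nonneg_right h4 (Real.exp_pos _).le
        _ = _ := one_mul _
    linarith
  · have hr0 : 0 ≤ r := by positivity
    have hclose : ‖θhat - θ‖ ≤ r := by
      by_contra! hfar
      have h0 := le_tukeyDepth_of_mem_halfspaceCountLE hp hn hX.1
      have h1 := tukeyDepth_le_of_mem_halfspaceCountLE hn hr0 hfar hX.2
      have hG := gaussianReal_real_Ioi_le hr0 (by rw [hr]; linarith)
      have hle := h0.trans ((hmed θ).trans h1)
      rw [gaussianReal_real_Ioi_zero] at hle
      have hG' := mul_le_mul_of_nonneg_left hG (by linarith : 0 ≤ 1 - ε)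
      have hgap : ε + 132 * δ < (1 - ε) * (4 / 27 * r) := by
        rw [hr]
        nlinarith
      linarith
    have hmax1 : (p : ℝ) / n ≤ max ((p : ℝ) / n) (ε ^ 2) := le_max_left _ _
    have hmax2 : ε ^ 2 ≤ max ((p : ℝ) / n) (ε ^ 2) := le_max_right _ _
    calc ‖θhat - θ‖ ^ 2 ≤ r ^ 2 := pow_le_pow_left₀ (norm_nonneg _) hclose 2
      _ ≤ 162 * (ε ^ 2 + 132 ^ 2 * δ ^ 2) := by
          rw [hr]
          nlinarith [sq_nonneg (ε - 132 * δ)]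
      _ ≤ 6 * 10 ^ 6 * max ((p : ℝ) / n) (ε ^ 2) := by
          rw [hδsq]
          nlinarith
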